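/- Let $\mathcal{L}$ be a uniform modular lattice, i.e. a modular lattice in which every chain contained in an interval is finite, such that for every $x$ the join $(x)^+$ of all elements covering $x$ exists and $x \mapsto (x)^+$ (the ascending operator) is an automorphism of $\mathcal{L}$. Let $n$ be its uniform-rank, i.e. the length of a maximal chain of $[x,(x)^+]$ (independent of $x$). For $x,y\in\mathcal{L}$, let $d_\infty(x,y) := \|a-b\|_\infty$, where $\Sigma$ is a $\mathbb{Z}^n$-skeleton containing $x$ and $y$ (a sublattice isomorphic to $\mathbb{Z}^n$ whose own ascending operator is the restriction of that of $\mathcal{L}$) and $a,b\in\mathbb{Z}^n$ correspond to $x,y$ under an isomorphism $\Sigma\simeq\mathbb{Z}^n$; the value does not depend on these choices. Let $g:\mathcal{L}\to\mathbb{R}\cup\{\infty\}$ be L-convex, i.e. $g(x)+g(y)\ge g(x\wedge y)+g(x\vee y)$ for all $x,y$, and for some $\alpha\in\mathbb{R}$, $g((x)^+)=g(x)+\alpha$ for all $x$. Suppose that $g$ has a minimizer, and let $x^0\in\mathcal{L}$ satisfy $g(x^0)<\infty$. The steepest descent algorithm started at $x^0$ repeats the following: at the current point $x^i$, find any minimizer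 $y$ of $g$ over $[x^i,(x^i)^+]$; if $g(y)<g(x^i)$, put $x^{i+1}:=y$ and continue; otherwise stop. Then the minimum $$k := \min\{\, d_\infty(x^0,y^*) \mid y^* \text{ is a minimizer of } g \text{ with } y^*\succeq x^0 \,\}$$ exists, the algorithm can be executed from $x^0$, and in every execution the $k$-th point $x^k$ exists (the algorithm does not stop earlier) and is a minimizer of $g$. -/

import Mathlib

/-- `f` is the ascending operator of the partially ordered set `P`: for every `x` the join of all
elements covering `x` exists and equals `f x`. -/
def IsAscendingOperator {P : Type*} [PartialOrder P] (f : P → P) : Prop :=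
  ∀ x, IsLUB {y | x ⋖ y} (f x)

/-- A uniform modular lattice: a modular lattice, all of whose intervals have only finite chains,
such that the ascending operator is defined and is an automorphism. -/
class UniformModularLattice (L : Type*) [Lattice L] : Prop extends IsModularLattice L where
  finite_of_isChain : ∀ (x y : L) (C : Set L), C ⊆ Set.Icc x y → IsChain (· ≤ ·) C → C.Finite
  exists_ascending : ∃ e : L ≃o L, IsAscendingOperator e

/-- The ascending operator `x ↦ (x)⁺` of a uniform modular lattice. -/
noncomputable def ascOp {L : Type*} [Lattice L] [UniformModularLattice L] : L ≃o L :=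
  Classical.choose (UniformModularLattice.exists_ascending (L := L))

theorem isAscendingOperator_ascOp {L : Type*} [Lattice L] [UniformModularLattice L] :
    IsAscendingOperator (ascOp : L ≃o L) :=
  Classical.choose_spec (UniformModularLattice.exists_ascending (L := L))

/-- The interval `[a, b]` has a maximal chain of length `m`, i.e. a chain from `a` to `b` with `m`
steps, each of which is a covering. -/
def HasMaximalChain {L : Type*} [Lattice L] (a b : L) (m : ℕ) : Prop :=
  ∃ c : ℕ → L, c 0 = a ∧ c m = b ∧ ∀ i < m, c i ⋖ c (i + 1)

/-- The uniform-rank: the length of a maximal chain of `[x, (x)⁺]`. (It depends neither on the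
maximal chain nor on `x`, so the infimum is over a single value when `L` is nonempty.) -/
noncomputable def uniformRank (L : Type*) [Lattice L] [UniformModularLattice L] : ℕ :=
  sInf {m | ∃ x : L, HasMaximalChain x (ascOp x) m}

/-- A `ℤⁿ`-skeleton, `n` the uniform-rank: a sublattice isomorphic to `ℤⁿ` whose own ascending
operator is the restriction of the ascending operator of `L`. -/
structure IsSkeleton {L : Type*} [Lattice L] [UniformModularLattice L] (S : Sublattice L) :
    Prop where
  iso : Nonempty ((Fin (uniformRank L) → ℤ) ≃o S)
  asc : ∃ f : S → S, IsAscendingOperator f ∧ ∀ x : S, (f x : L) = ascOp (x : L)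

/-- The `l_∞`-distance `‖a - b‖_∞` on `ℤⁿ`. -/
def supDist {n : ℕ} (a b : Fin n → ℤ) : ℕ :=
  Finset.univ.sup fun i => (a i - b i).natAbs

/-- The `l_∞`-distance `d_∞(x, y)`: take a skeleton containing `x` and `y`, identify it with `ℤⁿ`,
and measure there. The value does not depend on the skeleton or on the identification, see
`linfDist_eq`; hence every apartment system yields this same distance. -/
noncomputable def linfDist {L : Type*} [Lattice L] [UniformModularLattice L] (x y : L) : ℕ :=
  sInf {d | ∃ S : Sublattice L, IsSkeleton S ∧ ∃ e : (Fin (uniformRank L) → ℤ) ≃o S,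
    ∃ a b, (e a : L) = x ∧ (e b : L) = y ∧ d = supDist a b}

theorem isAscendingOperator_int (n : ℕ) :
    IsAscendingOperator (fun z : Fin n → ℤ => z + 1) := by
  intro z
  have hcov : ∀ i : Fin n, z ⋖ Function.update z i (z i + 1) := by
    intro i
    rw [Pi.covBy_iff]
    refine ⟨i, ?_, ?_⟩
    · simp
    · intro j hj
      simp [Function.update_of_ne hj]
  constructor
  · rintro y hy
    obtain ⟨i, hi, hj⟩ := Pi.covBy_iff.1 hy
    intro j
    rcases eq_or_ne j i with rfl | h
    · have := Order.covBy_iff_add_one_eq.1 hi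
      simp [this]
    · rw [← hj j h]; simp
  · intro w hw j
    have := hw (hcov j) j
    simpa using this

theorem IsSkeleton.ascOp_apply {L : Type*} [Lattice L] [UniformModularLattice L]
    {S : Sublattice L} (hS : IsSkeleton S) (e : (Fin (uniformRank L) → ℤ) ≃o S)
    (z : Fin (uniformRank L) → ℤ) : ascOp (e z : L) = (e (z + 1) : L) := by
  obtain ⟨f, hf, hfa⟩ := hS.asc
  rw [← hfa]
  congr 1
  refine (hf (e z)).unique ?_
  have h := (e.isLUB_image' (s := {y | z ⋖ y}) (x := z + 1)).2 (isAscendingOperator_int _ z)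
  have hs : e '' {y | z ⋖ y} = {y | e z ⋖ y} := by
    ext y
    constructor
    · rintro ⟨w, hw, rfl⟩
      exact (apply_covBy_apply_iff e).2 hw
    · intro hy
      refine ⟨e.symm y, ?_, by simp⟩
      have : e z ⋖ e (e.symm y) := by simpa using hy
      exact (apply_covBy_apply_iff e).1 this
  rwa [hs] at h

theorem IsSkeleton.supDist_le_iff {L : Type*} [Lattice L] [UniformModularLattice L]
    {S : Sublattice L} (hS : IsSkeleton S) (e : (Fin (uniformRank L) → ℤ) ≃o S)
    (a b : Fin (uniformRank L) → ℤ) (m : ℕ) :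
    supDist a b ≤ m ↔ (e b : L) ≤ ascOp^[m] (e a : L) ∧ (e a : L) ≤ ascOp^[m] (e b : L) := by
  have it : ∀ (m : ℕ) (z : Fin (uniformRank L) → ℤ),
      ascOp^[m] (e z : L) = (e (z + (m : Fin (uniformRank L) → ℤ)) : L) := by
    intro m
    induction m with
    | zero => intro z; simp
    | succ k ih =>
      intro z
      rw [Function.iterate_succ_apply, hS.ascOp_apply e, ih]
      have : z + 1 + (k : Fin (uniformRank L) → ℤ)
          = z + ((k + 1 : ℕ) : Fin (uniformRank L) → ℤ) := by
        push_cast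
        ring
      rw [this]
  rw [it, it, Subtype.coe_le_coe, Subtype.coe_le_coe, e.le_iff_le, e.le_iff_le, supDist,
    Finset.sup_le_iff]
  constructor
  · intro h
    constructor <;> intro i <;> have := h i (Finset.mem_univ i) <;>
      simp only [Pi.add_apply, Pi.natCast_apply] <;> omega
  · rintro ⟨h1, h2⟩ i -
    have h1 := h1 i
    have h2 := h2 i
    simp only [Pi.add_apply, Pi.natCast_apply] at h1 h2
    omega

/-- The `l_∞`-distance can be read off in any skeleton under any identification with `ℤⁿ`. -/
theorem linfDist_eq {L : Type*} [Lattice L] [UniformModularLattice L]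
    {S : Sublattice L} (hS : IsSkeleton S) (e : (Fin (uniformRank L) → ℤ) ≃o S)
    (a b : Fin (uniformRank L) → ℤ) : linfDist (e a : L) (e b : L) = supDist a b := by
  have : {d | ∃ S' : Sublattice L, IsSkeleton S' ∧ ∃ e' : (Fin (uniformRank L) → ℤ) ≃o S',
      ∃ a' b', (e' a' : L) = (e a : L) ∧ (e' b' : L) = (e b : L) ∧ d = supDist a' b'}
      = {supDist a b} := by
    ext d
    constructor
    · rintro ⟨S', hS', e', a', b', ha, hb, rfl⟩
      refine eq_of_forall_ge_iff fun m => ?_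
      rw [hS'.supDist_le_iff e', hS.supDist_le_iff e, ha, hb]
    · rintro rfl
      exact ⟨S, hS, e, a, b, rfl, rfl, rfl⟩
  rw [linfDist, this, csInf_singleton]

/-- An L-convex function `g : L → ℝ ∪ {∞}`. -/
structure IsLConvex {L : Type*} [Lattice L] [UniformModularLattice L] (g : L → WithTop ℝ) :
    Prop where
  submodular : ∀ x y, g (x ⊓ y) + g (x ⊔ y) ≤ g x + g y
  linear : ∃ α : ℝ, ∀ x, g (ascOp x) = g x + (α : WithTop ℝ)

/-- `y` is a (global) minimizer of `g`. -/
def IsMinimizer {L : Type*} (g : L → WithTop ℝ) (y : L) : Prop := ∀ z, g y ≤ g z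

/-- `y` is a steepest direction at `x`: a minimizer of `g` over `[x, (x)⁺]`. -/
def IsSteepestDirection {L : Type*} [Lattice L] [UniformModularLattice L] (g : L → WithTop ℝ)
    (x y : L) : Prop :=
  y ∈ Set.Icc x (ascOp x) ∧ ∀ z ∈ Set.Icc x (ascOp x), g y ≤ g z

/-- `x` records an execution of the steepest descent algorithm from `x₀`: `x i = some p` means that
the `i`-th point exists and is `p`, and `x i = none` that the algorithm stopped before producing an
`i`-th point. At the current point some steepest direction `y` is found; the algorithm moves to `y`
if this strictly decreases `g`, and stops otherwise. -/
structure IsSDARun {L : Type*} [Lattice L] [UniformModularLattice L] (g : L → WithTop ℝ) (x₀ : L)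
    (x : ℕ → Option L) : Prop where
  init : x 0 = some x₀
  step : ∀ i p, x i = some p → ∃ y, IsSteepestDirection g p y ∧
    ((g y < g p ∧ x (i + 1) = some y) ∨ (¬ g y < g p ∧ x (i + 1) = none))
  stopped : ∀ i, x i = none → x (i + 1) = none

/-!
Write `(x)^{+k}` for the `k`-th power of the ascending operator (`shift k x`).

*Distance.* For `x ≤ y`, the distance `linfDist x y` is the least `m` with `y ≤ (x)^{+m}`
(`linfDist_le_iff`). In a skeleton this is clear, so the point is that `x` and `y` lie in a common
skeleton. Skeletons are built from normal rays, the lattice analogue of the chains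
`x + t⁻ʲ e` of modules over a discrete valuation ring: a normal ray from `x` is a chain of coverings
`r 0 = x ⋖ r 1 ⋖ ⋯` with `(r j)⁺ = r (j + 1) ⊔ (x)⁺`. If `n` normal rays, `n` the uniform-rank, have
first elements joining to `(x)⁺`, then `e z = ⨆ i, r i (z i)` satisfies `(e z)⁺ = e (z + 1)`, and a
comparison of lengths, based on the Jordan–Dedekind condition, shows that no step
`e z ≤ e (z + eᵢ)` collapses and that `e` is a lattice embedding of `ℕⁿ` (`IsFrame.relLength_eq`,
`IsFrame.inf`). Shifting extends it to `ℤⁿ`, and its image is a skeleton (`IsFrame.isSkeleton`).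
Rays are continued upwards because intervals `[p, (p)⁺]` are complemented (`exists_relCompl`); rays
that run inside `[x, y]` as long as possible come from join-irreducible elements
(`exists_isRay`), and choosing their directions along the flag of shifted layers of `[x, y]` makes
`y` one of the points `e z` (`exists_isFrame`).

*Descent.* Since `g` has a finite minimum, its increment `α` along the ascending operator is zero,
so `g` is invariant under shifts. If `y` minimizes `g` over `[x, (x)⁺]` and `p` is a minimizer in
`[x, (x)^{+(k+1)}]`, then two applications of submodularity produce a minimizer in `[y, (y)^{+k}]`
(`IsSteepestDirection.exists_isMinimizer`). Hence each step lowers the distance to the minimizers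
above the current point by exactly one, and the algorithm cannot stop before this distance is zero.
A steepest direction exists although `[x, (x)⁺]` may be infinite (`exists_min_Icc`).
-/

/-! ### Lengths of maximal chains in modular lattices -/

section Length

variable {L : Type*} [Lattice L]

theorem HasMaximalChain.refl (a : L) : HasMaximalChain a a 0 :=
  ⟨fun _ => a, rfl, rfl, fun _ h => absurd h (Nat.not_lt_zero _)⟩

theorem HasMaximalChain.cons {a b c : L} {m : ℕ} (h : a ⋖ b) (hm : HasMaximalChain b c m) :
    HasMaximalChain a c (m + 1) := by
  obtain ⟨f, h0, h1, hf⟩ := hm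
  refine ⟨fun i => Nat.casesOn i a f, rfl, h1, ?_⟩
  rintro (_ | i) hi
  · simpa [h0] using h
  · exact hf i (by omega)

theorem HasMaximalChain.zero_iff {a b : L} : HasMaximalChain a b 0 ↔ a = b := by
  constructor
  · rintro ⟨f, rfl, rfl, -⟩
    rfl
  · rintro rfl
    exact .refl a

theorem HasMaximalChain.succ_iff {a b : L} {m : ℕ} :
    HasMaximalChain a b (m + 1) ↔ ∃ c, a ⋖ c ∧ HasMaximalChain c b m := by
  constructor
  · rintro ⟨f, rfl, rfl, hf⟩
    exact ⟨f 1, hf 0 (by omega), fun i => f (i + 1), rfl, rfl, fun i hi => hf (i + 1) (by omega)⟩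
  · rintro ⟨c, hac, hc⟩
    exact hc.cons hac

theorem HasMaximalChain.le {a b : L} {m : ℕ} (h : HasMaximalChain a b m) : a ≤ b := by
  induction m generalizing a with
  | zero => exact (zero_iff.1 h).le
  | succ m ih =>
    obtain ⟨c, hac, hc⟩ := succ_iff.1 h
    exact hac.le.trans (ih hc)

theorem HasMaximalChain.trans {a b c : L} {m k : ℕ} (h : HasMaximalChain a b m)
    (h' : HasMaximalChain b c k) : HasMaximalChain a c (m + k) := by
  induction m generalizing a with
  | zero => rw [zero_iff.1 h, Nat.zero_add]; exact h'
  | succ m ih =>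
    obtain ⟨d, had, hd⟩ := succ_iff.1 h
    rw [Nat.add_right_comm]
    exact (ih hd).cons had

theorem HasMaximalChain.map {a b : L} {m : ℕ} (h : HasMaximalChain a b m) (e : L ≃o L) :
    HasMaximalChain (e a) (e b) m := by
  obtain ⟨f, rfl, rfl, hf⟩ := h
  exact ⟨fun i => e (f i), rfl, rfl, fun i hi => (apply_covBy_apply_iff e).2 (hf i hi)⟩

theorem CovBy.sup_eq_of_not_le {a b c : L} (h : a ⋖ b) (hc : c ≤ b) (hca : ¬ c ≤ a) :
    a ⊔ c = b := by
  rcases h.eq_or_eq le_sup_left (sup_le h.le hc) with h1 | h1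
  · exact absurd (h1 ▸ le_sup_right) hca
  · exact h1

theorem HasMaximalChain.of_forall_covBy {r : ℕ → L} (h : ∀ j, r j ⋖ r (j + 1)) {j k : ℕ}
    (hjk : j ≤ k) : HasMaximalChain (r j) (r k) (k - j) :=
  ⟨fun i => r (j + i), rfl, by simp [Nat.add_sub_cancel' hjk], fun i _ => h (j + i)⟩

variable [IsModularLattice L]

/-- In a modular lattice, joining both sides of a covering with `c` gives a covering, unless it
collapses the two sides. -/
theorem CovBy.sup_left_or_eq {a b : L} (h : a ⋖ b) (c : L) : c ⊔ a ⋖ c ⊔ b ∨ c ⊔ a = c ⊔ b := by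
  by_cases hb : b ≤ c ⊔ a
  · exact Or.inr (le_antisymm (sup_le_sup_left h.le c) (sup_le le_sup_left hb))
  · left
    have h1 : b ⊓ (c ⊔ a) = a := by
      rcases h.eq_or_eq (le_inf h.le le_sup_right) inf_le_left with h1 | h1
      · exact h1
      · exact absurd (inf_eq_left.1 h1) hb
    have h2 : c ⊔ b = b ⊔ (c ⊔ a) := by
      rw [sup_comm c a, ← sup_assoc, sup_eq_left.2 h.le, sup_comm]
    rw [h2]
    exact covBy_sup_of_inf_covBy_left (by rwa [h1])

theorem HasMaximalChain.of_covBy {a b c : L} {m : ℕ} (h : HasMaximalChain a b m) (hac : a ⋖ c)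
    (hcb : c ≤ b) : ∃ k, m = k + 1 ∧ HasMaximalChain c b k := by
  induction m generalizing a c with
  | zero => exact absurd (hcb.trans (zero_iff.1 h).ge) hac.lt.not_ge
  | succ m ih =>
    refine ⟨m, rfl, ?_⟩
    obtain ⟨d, had, hd⟩ := succ_iff.1 h
    by_cases hdc : c = d
    · exact hdc ▸ hd
    have h1 : d ⊓ c = a := by
      rcases had.eq_or_eq (le_inf had.le hac.le) inf_le_left with h1 | h1
      · exact h1
      · exact absurd ((hac.eq_or_eq had.le (inf_eq_left.1 h1)).resolve_left had.ne').symm hdc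
    have h2 : d ⋖ d ⊔ c := covBy_sup_of_inf_covBy_right (by rwa [h1])
    have h3 : c ⋖ d ⊔ c := covBy_sup_of_inf_covBy_left (by rwa [h1])
    obtain ⟨k, rfl, hk⟩ := ih hd h2 (sup_le hd.le hcb)
    exact hk.cons h3

/-- The Jordan–Dedekind chain condition. -/
theorem HasMaximalChain.unique {a b : L} {m k : ℕ} (h : HasMaximalChain a b m)
    (h' : HasMaximalChain a b k) : m = k := by
  induction m generalizing a k with
  | zero =>
    cases k with
    | zero => rfl
    | succ k =>
      obtain ⟨c, hac, hc⟩ := succ_iff.1 h'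
      exact absurd (hc.le.trans (zero_iff.1 h).ge) hac.lt.not_ge
  | succ m ih =>
    obtain ⟨c, hac, hc⟩ := succ_iff.1 h
    obtain ⟨j, rfl, hj⟩ := h'.of_covBy hac hc.le
    rw [ih hc hj]

/-- The length of the interval `[a, b]`, meaningful when `[a, b]` has a maximal chain. -/
noncomputable def relLength (a b : L) : ℕ := sInf {m | HasMaximalChain a b m}

theorem HasMaximalChain.relLength_eq {a b : L} {m : ℕ} (h : HasMaximalChain a b m) :
    relLength a b = m :=
  (Nat.sInf_mem (⟨m, h⟩ : {m | HasMaximalChain a b m}.Nonempty)).unique h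

end Length

section FiniteChains

variable {L : Type*} [Lattice L] [UniformModularLattice L]

theorem wellFounded_lt_Icc (a b : L) : WellFoundedLT (Set.Icc a b) := by
  rw [WellFoundedLT, isWellFounded_iff, RelEmbedding.wellFounded_iff_isEmpty]
  refine ⟨fun f => ?_⟩
  have hf : ∀ i j, i ≤ j → (f j : L) ≤ f i := fun i j h => by
    rcases h.eq_or_lt with rfl | h
    · exact le_rfl
    · exact le_of_lt (f.map_rel_iff.2 h : f j < f i)
  have h := UniformModularLattice.finite_of_isChain a b (Set.range fun i => (f i : L))
    (by rintro _ ⟨i, rfl⟩; exact (f i).2)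
    (by
      rintro _ ⟨i, rfl⟩ _ ⟨j, rfl⟩ -
      exact (le_total j i).imp (hf _ _) (hf _ _))
  exact Set.infinite_range_of_injective (Subtype.val_injective.comp f.injective) h

theorem wellFounded_gt_Icc (a b : L) : WellFoundedGT (Set.Icc a b) := by
  rw [WellFoundedGT, isWellFounded_iff, RelEmbedding.wellFounded_iff_isEmpty]
  refine ⟨fun f => ?_⟩
  have hf : ∀ i j, i ≤ j → (f i : L) ≤ f j := fun i j h => by
    rcases h.eq_or_lt with rfl | h
    · exact le_rfl
    · exact le_of_lt (f.map_rel_iff.2 h : f i < f j)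
  have h := UniformModularLattice.finite_of_isChain a b (Set.range fun i => (f i : L))
    (by rintro _ ⟨i, rfl⟩; exact (f i).2)
    (by
      rintro _ ⟨i, rfl⟩ _ ⟨j, rfl⟩ -
      exact (le_total i j).imp (hf _ _) (hf _ _))
  exact Set.infinite_range_of_injective (Subtype.val_injective.comp f.injective) h

theorem exists_minimal_Icc {a b : L} (p : L → Prop) (h : ∃ x ∈ Set.Icc a b, p x) :
    ∃ x ∈ Set.Icc a b, p x ∧ ∀ y ∈ Set.Icc a b, p y → y ≤ x → y = x := by
  obtain ⟨x, hx, hp⟩ := h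
  have := wellFounded_lt_Icc a b
  obtain ⟨m, hm, hmin⟩ := wellFounded_lt.has_min {z : Set.Icc a b | p z} ⟨⟨x, hx⟩, hp⟩
  refine ⟨m, m.2, hm, fun y hy hpy hle => ?_⟩
  by_contra hne
  exact hmin ⟨y, hy⟩ hpy (lt_of_le_of_ne hle fun h => hne (congrArg Subtype.val h))

theorem exists_maximal_Icc {a b : L} (p : L → Prop) (h : ∃ x ∈ Set.Icc a b, p x) :
    ∃ x ∈ Set.Icc a b, p x ∧ ∀ y ∈ Set.Icc a b, p y → x ≤ y → y = x := by
  obtain ⟨x, hx, hp⟩ := h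
  have := wellFounded_gt_Icc a b
  obtain ⟨m, hm, hmin⟩ := wellFounded_gt.has_min {z : Set.Icc a b | p z} ⟨⟨x, hx⟩, hp⟩
  refine ⟨m, m.2, hm, fun y hy hpy hle => ?_⟩
  by_contra hne
  exact hmin ⟨y, hy⟩ hpy (lt_of_le_of_ne hle fun h => hne (congrArg Subtype.val h).symm)

theorem exists_hasMaximalChain {a b : L} (h : a ≤ b) : ∃ m, HasMaximalChain a b m := by
  obtain ⟨c, hc, ⟨m, hm⟩, hmin⟩ := exists_minimal_Icc (a := a) (b := b)
    (fun c => ∃ m, HasMaximalChain c b m) ⟨b, ⟨h, le_rfl⟩, 0, .refl b⟩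
  rcases hc.1.eq_or_lt with rfl | hac
  · exact ⟨m, hm⟩
  exfalso
  -- an element covered by `c` would start a maximal chain as well
  obtain ⟨d, hd, hdc, hmax⟩ := exists_maximal_Icc (a := a) (b := c) (fun d => d < c)
    ⟨a, ⟨le_rfl, hac.le⟩, hac⟩
  have hcov : d ⋖ c := ⟨hdc, fun e hde hec =>
    hde.ne' (hmax e ⟨hd.1.trans hde.le, hec.le⟩ hec hde.le)⟩
  exact hdc.ne (hmin d ⟨hd.1, hdc.le.trans hc.2⟩ ⟨m + 1, hm.cons hcov⟩ hdc.le)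

theorem hasMaximalChain_relLength {a b : L} (h : a ≤ b) : HasMaximalChain a b (relLength a b) := by
  obtain ⟨m, hm⟩ := exists_hasMaximalChain h
  rwa [hm.relLength_eq]

theorem relLength_add {a b c : L} (h : a ≤ b) (h' : b ≤ c) :
    relLength a b + relLength b c = relLength a c :=
  ((hasMaximalChain_relLength h).trans (hasMaximalChain_relLength h')).relLength_eq.symm

theorem eq_of_relLength_eq_zero {a b : L} (h : a ≤ b) (h0 : relLength a b = 0) : a = b :=
  HasMaximalChain.zero_iff.1 (h0 ▸ hasMaximalChain_relLength h)

theorem relLength_map (e : L ≃o L) {a b : L} (h : a ≤ b) :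
    relLength (e a) (e b) = relLength a b :=
  ((hasMaximalChain_relLength h).map e).relLength_eq

theorem relLength_sup_le (p : L) {a b : L} (h : a ≤ b) :
    relLength (p ⊔ a) (p ⊔ b) ≤ relLength a b := by
  have key : ∀ (m : ℕ) (a : L), HasMaximalChain a b m → relLength (p ⊔ a) (p ⊔ b) ≤ m := by
    intro m
    induction m with
    | zero =>
      intro a h
      rw [HasMaximalChain.zero_iff.1 h, (HasMaximalChain.refl _).relLength_eq]
    | succ m ih =>
      intro a h
      obtain ⟨c, hac, hc⟩ := HasMaximalChain.succ_iff.1 h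
      rcases hac.sup_left_or_eq p with h1 | h1
      · rw [((hasMaximalChain_relLength (sup_le_sup_left hc.le p)).cons h1).relLength_eq]
        exact Nat.succ_le_succ (ih c hc)
      · rw [h1]
        exact (ih c hc).trans (Nat.le_succ m)
  exact key _ a (hasMaximalChain_relLength h)

end FiniteChains

/-! ### Powers of the ascending operator -/

section Shift

variable {L : Type*} [Lattice L] [UniformModularLattice L]

/-- The `k`-th power of the ascending operator, for any integer `k`. -/
noncomputable def shift (k : ℤ) (x : L) : L := ((ascOp : L ≃o L) ^ k) x

theorem shift_one (x : L) : shift 1 x = ascOp x := by simp [shift]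

@[simp]
theorem shift_zero (x : L) : shift 0 x = x := by simp [shift]

@[simp]
theorem shift_shift (a b : ℤ) (x : L) : shift a (shift b x) = shift (a + b) x := by
  simp [shift, zpow_add, RelIso.mul_apply]

@[simp]
theorem shift_le_shift_iff (a : ℤ) {x y : L} : shift a x ≤ shift a y ↔ x ≤ y :=
  OrderIso.le_iff_le _

theorem shift_sup (a : ℤ) (x y : L) : shift a (x ⊔ y) = shift a x ⊔ shift a y :=
  OrderIso.map_sup _ x y

theorem shift_inf (a : ℤ) (x y : L) : shift a (x ⊓ y) = shift a x ⊓ shift a y :=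
  OrderIso.map_inf _ x y

theorem CovBy.map_shift {x y : L} (h : x ⋖ y) (a : ℤ) : shift a x ⋖ shift a y :=
  (apply_covBy_apply_iff ((ascOp : L ≃o L) ^ a)).2 h

theorem shift_injective (a : ℤ) : Function.Injective (shift a : L → L) :=
  OrderIso.injective _

theorem shift_le_iff (a : ℤ) {x y : L} : shift a x ≤ y ↔ x ≤ shift (-a) y := by
  rw [← shift_le_shift_iff (-a)]
  simp

theorem relLength_shift (a : ℤ) {x y : L} (h : x ≤ y) :
    relLength (shift a x) (shift a y) = relLength x y :=
  relLength_map _ h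

theorem shift_natCast (m : ℕ) (x : L) : shift m x = ascOp^[m] x := by
  induction m with
  | zero => simp
  | succ m ih =>
    rw [Function.iterate_succ_apply', ← ih, ← shift_one, shift_shift, Nat.cast_succ, add_comm]

theorem CovBy.le_shift_one {x y : L} (h : x ⋖ y) : y ≤ shift 1 x := by
  rw [shift_one]
  exact (isAscendingOperator_ascOp x).1 h

theorem le_shift_one (x : L) : x ≤ shift 1 x := by
  by_cases h : ∃ y, x ⋖ y
  · obtain ⟨y, hy⟩ := h
    exact hy.le.trans hy.le_shift_one
  · -- an empty join is a least element, and automorphisms fix the least element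
    have hbot : ∀ y, shift 1 x ≤ y := by
      intro y
      rw [shift_one]
      exact (isAscendingOperator_ascOp x).2 fun z hz => absurd ⟨z, hz⟩ h
    have := (shift_le_iff 1).1 (hbot (shift 1 (shift 1 x)))
    simpa using this

theorem shift_mono_left {a b : ℤ} (h : a ≤ b) (x : L) : shift a x ≤ shift b x := by
  induction b, h using Int.leInduction with
  | base => exact le_rfl
  | succ b _ ih =>
    refine ih.trans ?_
    rw [add_comm, ← shift_shift]
    exact le_shift_one _

theorem exists_le_shift {x y : L} (h : x ≤ y) : ∃ m : ℕ, y ≤ shift m x := by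
  obtain ⟨m, hm⟩ := exists_hasMaximalChain h
  refine ⟨m, ?_⟩
  clear h
  induction m generalizing x with
  | zero => simp [HasMaximalChain.zero_iff.1 hm]
  | succ m ih =>
    obtain ⟨c, hxc, hc⟩ := HasMaximalChain.succ_iff.1 hm
    refine (ih hc).trans ?_
    rw [Nat.cast_succ, ← shift_shift, shift_le_shift_iff]
    exact hxc.le_shift_one

/-- The intervals `[p, q]` with `q ≤ (p)⁺` are complemented, since `(p)⁺` is a join of elements
covering `p`. -/
theorem exists_relCompl {p w q : L} (hpw : p ≤ w) (hwq : w ≤ q) (hq : q ≤ shift 1 p) :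
    ∃ s, p ≤ s ∧ s ≤ q ∧ s ⊓ w = p ∧ s ⊔ w = q := by
  obtain ⟨s, hs, hsw, hmax⟩ := exists_maximal_Icc (a := p) (b := shift 1 p) (fun s => s ⊓ w = p)
    ⟨p, ⟨le_rfl, le_shift_one p⟩, inf_eq_left.2 hpw⟩
  have htop : shift 1 p ≤ s ⊔ w := by
    rw [shift_one]
    refine (isAscendingOperator_ascOp p).2 fun a (ha : p ⋖ a) => ?_
    by_contra hna
    have h1 : a ⊓ (s ⊔ w) = p := by
      rcases ha.eq_or_eq (le_inf ha.le (hs.1.trans le_sup_left)) inf_le_left with h | h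
      · exact h
      · exact absurd (inf_eq_left.1 h) hna
    have h2 : (s ⊔ a) ⊓ (s ⊔ w) = s := by
      rw [sup_inf_assoc_of_le a (le_sup_left : s ≤ s ⊔ w), h1, sup_eq_left.2 hs.1]
    have h3 : (s ⊔ a) ⊓ w = p := by
      refine le_antisymm ?_ (le_inf (hs.1.trans le_sup_left) hpw)
      rw [← hsw]
      exact le_inf ((inf_le_inf_left _ le_sup_right).trans h2.le) inf_le_right
    have h4 := hmax (s ⊔ a) ⟨hs.1.trans le_sup_left, sup_le hs.2 ha.le_shift_one⟩ h3 le_sup_left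
    exact hna ((sup_eq_left.1 h4).trans le_sup_left)
  refine ⟨s ⊓ q, le_inf hs.1 (hpw.trans hwq), inf_le_right, ?_, ?_⟩
  · rw [inf_assoc, inf_eq_right.2 hwq, hsw]
  · rw [sup_comm, ← sup_inf_assoc_of_le s hwq, sup_comm, inf_eq_right.2 (hq.trans htop)]

theorem relLength_shift_one_eq (x y : L) :
    relLength x (shift 1 x) = relLength y (shift 1 y) := by
  have key : ∀ x y : L, x ≤ y → relLength x (shift 1 x) = relLength y (shift 1 y) := by
    intro x y h
    have h1 := relLength_add h (le_shift_one y)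
    have h2 := relLength_add (le_shift_one x) ((shift_le_shift_iff 1).2 h)
    rw [relLength_shift 1 h] at h2
    omega
  rw [key x (x ⊔ y) le_sup_left, key y (x ⊔ y) le_sup_right]

theorem relLength_shift_one (x : L) : relLength x (shift 1 x) = uniformRank L := by
  have hne : {m | ∃ x : L, HasMaximalChain x (ascOp x) m}.Nonempty := by
    refine ⟨relLength x (shift 1 x), x, ?_⟩
    rw [← shift_one]
    exact hasMaximalChain_relLength (le_shift_one x)
  obtain ⟨y, hy⟩ := Nat.sInf_mem hne
  rw [relLength_shift_one_eq x y, shift_one, uniformRank, hy.relLength_eq]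

theorem relLength_shift_natCast (m : ℕ) (x : L) :
    relLength x (shift m x) = m * uniformRank L := by
  induction m with
  | zero => simp [(HasMaximalChain.refl x).relLength_eq]
  | succ m ih =>
    have h1 : shift ((m + 1 : ℕ) : ℤ) x = shift 1 (shift m x) := by
      rw [shift_shift, Nat.cast_succ, add_comm]
    have h2 : x ≤ shift m x := by simpa using shift_mono_left (Int.natCast_nonneg m) x
    rw [h1, ← relLength_add h2 (le_shift_one _), relLength_shift_one, ih, Nat.succ_mul]

end Shift

/-! ### Normal rays -/

section Ray

variable {L : Type*} [Lattice L] [UniformModularLattice L]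

/-- A normal ray from `x`: an infinite chain of coverings starting at `x`, no two consecutive steps
of which stay within `[r j, (r j)⁺]`. The second condition is expressed by the equivalent
recursion `(r j)⁺ = r (j + 1) ⊔ (x)⁺`. -/
structure IsRay (x : L) (r : ℕ → L) : Prop where
  zero : r 0 = x
  covBy : ∀ j, r j ⋖ r (j + 1)
  shift_eq : ∀ j, shift 1 (r j) = r (j + 1) ⊔ shift 1 x

theorem IsRay.monotone {x : L} {r : ℕ → L} (h : IsRay x r) : Monotone r :=
  monotone_nat_of_le_succ fun j => (h.covBy j).le

theorem IsRay.shift_le {x : L} {r : ℕ → L} (h : IsRay x r) (j k : ℕ) :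
    shift k (r j) ≤ shift k x ⊔ r (j + k) := by
  induction k with
  | zero => simp
  | succ k ih =>
    have h1 : ∀ y : L, shift ((k + 1 : ℕ) : ℤ) y = shift 1 (shift k y) := fun y => by
      rw [shift_shift, Nat.cast_succ, add_comm]
    rw [h1, h1]
    refine ((shift_le_shift_iff 1).2 ih).trans ?_
    rw [shift_sup, h.shift_eq, ← add_assoc]
    refine sup_le le_sup_left (sup_le le_sup_right (le_sup_of_le_left ?_))
    rw [shift_le_shift_iff]
    simpa using shift_mono_left (Int.natCast_nonneg k) x

/-- A step `p ⋖ q` with `(p)⁺ = q ⊔ (x)⁺` can be continued for ever: a next element is a complement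
of `(p)⁺` in `[q, (q)⁺]`. -/
theorem exists_extension {x p q : L} (hpq : p ⋖ q) (hp : shift 1 p = q ⊔ shift 1 x) :
    ∃ v : ℕ → L, v 0 = p ∧ v 1 = q ∧ (∀ j, v j ⋖ v (j + 1)) ∧
      ∀ j, shift 1 (v j) = v (j + 1) ⊔ shift 1 x := by
  have step : ∀ u : {u : L × L // u.1 ⋖ u.2 ∧ shift 1 u.1 = u.2 ⊔ shift 1 x},
      ∃ u' : {u : L × L // u.1 ⋖ u.2 ∧ shift 1 u.1 = u.2 ⊔ shift 1 x}, u'.1.1 = u.1.2 := by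
    rintro ⟨⟨p, q⟩, hpq, hp⟩
    simp only at hpq hp
    obtain ⟨s, h1, h2, h3, h4⟩ := exists_relCompl hpq.le_shift_one (hpq.map_shift 1).le le_rfl
    refine ⟨⟨(q, s), ?_, ?_⟩, rfl⟩
    · have : shift 1 p ⋖ s ⊔ shift 1 p := by
        rw [h4]
        exact hpq.map_shift 1
      have := inf_covBy_of_covBy_sup_right this
      rwa [h3] at this
    · show shift 1 q = s ⊔ shift 1 x
      rw [← h4, hp, ← sup_assoc, sup_eq_left.2 h1]
  choose f hf using step
  let u : ℕ → {u : L × L // u.1 ⋖ u.2 ∧ shift 1 u.1 = u.2 ⊔ shift 1 x} :=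
    fun j => f^[j] ⟨(p, q), hpq, hp⟩
  have hu : ∀ j, (u (j + 1)).1.1 = (u j).1.2 := fun j => by
    simp only [u, Function.iterate_succ_apply']
    exact hf _
  refine ⟨fun j => (u j).1.1, rfl, hu 0, fun j => ?_, fun j => ?_⟩
  · simp only [hu]
    exact (u j).2.1
  · simp only [hu]
    exact (u j).2.2

/-- Normal rays with prescribed direction and prescribed length inside `[x, y]`: if `y` accounts
for the step from `c` to `c'` shifted `k` times, then some normal ray from `x` has its first
element in `[x, c']` but not below `c`, and its `(k + 1)`-st element below `y`. That element is
join-irreducible over `x`; the ray is continued above it, then cut down by `v ↦ x ⊔ (v)^{-k}`. -/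
theorem exists_isRay {x y c c' : L} (hxc : x ≤ c) (hcc : c ⋖ c') (hc : c' ≤ shift 1 x) (k : ℕ)
    (hxy : x ≤ y) (hk : shift k c' ≤ shift k c ⊔ y) :
    ∃ r, IsRay x r ∧ r 1 ≤ c' ∧ ¬ r 1 ≤ c ∧ r (k + 1) ≤ y := by
  have hxk : x ≤ shift k x := by simpa using shift_mono_left (Int.natCast_nonneg k) x
  have hxkc : x ≤ shift k c := hxk.trans (by simpa using hxc)
  have hcck := hcc.map_shift k
  -- `s` is a minimal witness; it is join-irreducible over `x`, with lower cover `s ⊓ shift k c`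
  obtain ⟨s, hs, hsk, hmin⟩ := exists_minimal_Icc (a := x) (b := y)
    (fun s => shift k c' ≤ shift k c ⊔ s) ⟨y, ⟨hxy, le_rfl⟩, hk⟩
  have hsc' : s ≤ shift k c' := by
    have := hmin (s ⊓ shift k c') ⟨le_inf hs.1 (hxkc.trans hcck.le), inf_le_left.trans hs.2⟩ (by
      rw [← sup_inf_assoc_of_le s hcck.le]
      exact le_inf hsk le_rfl) inf_le_left
    exact inf_eq_left.1 this
  have hsc : ¬ s ≤ shift k c := fun h => hcck.lt.not_ge (hsk.trans (sup_le le_rfl h))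
  have hsup : shift k c ⊔ s = shift k c' := le_antisymm (sup_le hcck.le hsc') hsk
  have hirr : ∀ w, x ≤ w → w ≤ s → w ≠ s → w ≤ shift k c := by
    intro w hw hws hne
    by_contra hwc
    have := hcck.sup_eq_of_not_le (hws.trans hsc') hwc
    exact hne (hmin w ⟨hw, hws.trans hs.2⟩ this.ge hws)
  have hsx : shift (-1) s ≤ shift k x := by
    rw [shift_le_iff, neg_neg, shift_shift, add_comm, ← shift_shift]
    exact hsc'.trans ((shift_le_shift_iff _).2 hc)
  have hqp : x ⊔ shift (-1) s ≤ s ⊓ shift k c := by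
    refine le_inf (sup_le hs.1 ?_) (sup_le hxkc (hsx.trans (by simpa using hxc)))
    simpa using shift_mono_left (show (-1 : ℤ) ≤ 0 by norm_num) s
  have hps : s ⊓ shift k c ⋖ s := by
    have : shift k c ⋖ s ⊔ shift k c := by rwa [sup_comm, hsup]
    exact inf_covBy_of_covBy_sup_right this
  have hq : x ⊔ shift (-1) s ⋖ s := by
    have h1 : s ≤ shift 1 (x ⊔ shift (-1) s) := by
      rw [shift_sup]
      exact le_sup_of_le_right (by simp)
    obtain ⟨w, hw1, hw2, hw3, hw4⟩ := exists_relCompl hqp inf_le_left h1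
    by_cases hws : w = s
    · rw [← hw3, hws, inf_eq_right.2 hps.le]
      exact hps
    · have := le_inf hw2 (hirr w (le_sup_left.trans hw1) hw2 hws)
      rw [sup_eq_right.2 this] at hw4
      exact absurd hw4 hps.ne
  obtain ⟨v, hv0, hv1, hv, hvs⟩ := exists_extension (x := x) hq (by
    rw [shift_sup, sup_comm]
    simp)
  have hxv : ∀ j, x ≤ v j := by
    intro j
    have : v 0 ≤ v j := monotone_nat_of_le_succ (fun j => (hv j).le) (Nat.zero_le j)
    exact (le_sup_left.trans hv0.ge).trans this
  have hback : ∀ i j : ℕ, x ⊔ shift (-i) (v (j + i)) = v j := by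
    intro i
    induction i with
    | zero =>
      intro j
      simpa using hxv j
    | succ i ih =>
      intro j
      have h1 : v (j + i) = shift (-1) (v (j + i + 1)) ⊔ x := by
        have := congrArg (shift (-1)) (hvs (j + i))
        rw [shift_sup] at this
        simpa using this
      have h2 : shift (-(i : ℤ)) x ≤ x := by
        simpa using shift_mono_left (show -(i : ℤ) ≤ 0 by omega) x
      conv_rhs => rw [← ih j, h1, shift_sup, shift_shift]
      rw [← add_assoc, Nat.cast_succ, neg_add, sup_comm (shift _ _) (shift _ x), ← sup_assoc,
        sup_eq_left.2 h2]
  have hts : ∀ j, shift 1 (x ⊔ shift (-k) (v j)) = (x ⊔ shift (-k) (v (j + 1))) ⊔ shift 1 x := by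
    intro j
    have h1 : shift (-(k : ℤ)) (shift 1 x) ≤ shift 1 x := by
      simpa using shift_mono_left (show -(k : ℤ) ≤ 0 by omega) (shift 1 x)
    rw [shift_sup, shift_shift, add_comm, ← shift_shift, hvs, shift_sup]
    refine le_antisymm (sup_le le_sup_right (sup_le ?_ (h1.trans le_sup_right))) ?_
    · exact le_sup_of_le_left le_sup_right
    · refine sup_le (sup_le ((le_shift_one x).trans le_sup_left) ?_) le_sup_left
      exact le_sup_of_le_right le_sup_left
  have hsc1 : ¬ x ⊔ shift (-k) (v 1) ≤ c := by
    rw [hv1]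
    intro h
    have := le_sup_right.trans h
    rw [shift_le_iff, neg_neg] at this
    exact hsc this
  have hzero : x ⊔ shift (-k) (v 0) = x := by
    rw [sup_eq_left, hv0, shift_le_iff, neg_neg]
    exact sup_le hxk hsx
  -- a repetition would propagate down to the start of the ray
  have hne : ∀ j, x ⊔ shift (-k) (v j) ≠ x ⊔ shift (-k) (v (j + 1)) := by
    intro j
    induction j with
    | zero =>
      intro h
      rw [hzero] at h
      exact hsc1 (h.ge.trans hxc)
    | succ j ih =>
      intro h
      refine ih (shift_injective 1 ?_)
      rw [hts, hts, h]
  refine ⟨fun j => x ⊔ shift (-k) (v j), ⟨hzero, ?_, hts⟩, ?_, hsc1, ?_⟩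
  · intro j
    refine ((hv j).map_shift (-k)).sup_left_or_eq x |>.resolve_right fun heq => ?_
    exact hne j heq
  · show x ⊔ shift (-k) (v 1) ≤ c'
    rw [hv1]
    refine sup_le (hxc.trans hcc.le) ?_
    rwa [shift_le_iff, neg_neg]
  · show x ⊔ shift (-k) (v (k + 1)) ≤ y
    rw [add_comm, hback, hv1]
    exact hs.2

end Ray

/-! ### Skeletons spanned by normal rays -/

section Frame

variable {L : Type*} [Lattice L]

/-- The join of `x` and the points `r i (z i)` for `i < j`. -/
def frameJoin (x : L) (r : ℕ → ℕ → L) (z : ℕ → ℕ) : ℕ → L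
  | 0 => x
  | j + 1 => frameJoin x r z j ⊔ r j (z j)

theorem frameJoin_le_iff {x : L} {r : ℕ → ℕ → L} {z : ℕ → ℕ} {j : ℕ} {w : L} :
    frameJoin x r z j ≤ w ↔ x ≤ w ∧ ∀ i < j, r i (z i) ≤ w := by
  induction j with
  | zero => simp [frameJoin]
  | succ j ih => rw [frameJoin, sup_le_iff, ih, Nat.forall_lt_succ_right, and_assoc]

theorem le_frameJoin (x : L) (r : ℕ → ℕ → L) (z : ℕ → ℕ) (j : ℕ) : x ≤ frameJoin x r z j :=
  (frameJoin_le_iff.1 le_rfl).1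

theorem apply_le_frameJoin (x : L) (r : ℕ → ℕ → L) (z : ℕ → ℕ) {i j : ℕ} (h : i < j) :
    r i (z i) ≤ frameJoin x r z j :=
  (frameJoin_le_iff.1 le_rfl).2 i h

variable [UniformModularLattice L]

/-- A frame at `x`: as many normal rays from `x` as the uniform-rank, whose first elements join to
`(x)⁺`. The rays are `r i` for `i < uniformRank L`; the other values of `r` are irrelevant. -/
structure IsFrame (x : L) (r : ℕ → ℕ → L) : Prop where
  isRay : ∀ i < uniformRank L, IsRay x (r i)
  span : shift 1 x ≤ frameJoin x r (fun _ => 1) (uniformRank L)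

namespace IsFrame

variable {x : L} {r : ℕ → ℕ → L}

theorem mono (h : IsFrame x r) {z w : ℕ → ℕ} {j : ℕ} (hj : j ≤ uniformRank L)
    (hzw : ∀ i < j, z i ≤ w i) : frameJoin x r z j ≤ frameJoin x r w j :=
  frameJoin_le_iff.2 ⟨le_frameJoin x r w j, fun i hi =>
    ((h.isRay i (hi.trans_le hj)).monotone (hzw i hi)).trans (apply_le_frameJoin x r w hi)⟩

theorem congr (h : IsFrame x r) {z w : ℕ → ℕ} (hzw : ∀ i < uniformRank L, z i = w i) :
    frameJoin x r z (uniformRank L) = frameJoin x r w (uniformRank L) :=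
  le_antisymm (h.mono le_rfl fun i hi => (hzw i hi).le) (h.mono le_rfl fun i hi => (hzw i hi).ge)

theorem sup (h : IsFrame x r) (z w : ℕ → ℕ) :
    frameJoin x r (z ⊔ w) (uniformRank L) =
      frameJoin x r z (uniformRank L) ⊔ frameJoin x r w (uniformRank L) := by
  refine le_antisymm (frameJoin_le_iff.2 ⟨(le_frameJoin x r z _).trans le_sup_left, ?_⟩)
    (sup_le (h.mono le_rfl fun i _ => le_sup_left) (h.mono le_rfl fun i _ => le_sup_right))
  intro i hi
  rw [Pi.sup_apply, (h.isRay i hi).monotone.map_sup]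
  exact sup_le_sup (apply_le_frameJoin x r z hi) (apply_le_frameJoin x r w hi)

theorem shift_one (h : IsFrame x r) (z : ℕ → ℕ) :
    shift 1 (frameJoin x r z (uniformRank L)) = frameJoin x r (z + 1) (uniformRank L) := by
  have hx : shift 1 x ≤ frameJoin x r (z + 1) (uniformRank L) :=
    h.span.trans (h.mono le_rfl fun i _ => by simp)
  refine le_antisymm ?_ (frameJoin_le_iff.2 ⟨?_, fun i hi => ?_⟩)
  · rw [shift_le_iff]
    refine frameJoin_le_iff.2 ⟨by rwa [← shift_le_iff], fun i hi => ?_⟩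
    rw [← shift_le_iff, (h.isRay i hi).shift_eq]
    exact sup_le (apply_le_frameJoin x r (z + 1) hi) hx
  · exact (le_shift_one x).trans ((shift_le_shift_iff 1).2 (le_frameJoin x r z _))
  · exact ((h.isRay i hi).covBy (z i)).le_shift_one.trans
      ((shift_le_shift_iff 1).2 (apply_le_frameJoin x r z hi))

theorem zero (h : IsFrame x r) : frameJoin x r 0 (uniformRank L) = x :=
  le_antisymm (frameJoin_le_iff.2 ⟨le_rfl, fun i hi => (h.isRay i hi).zero.le⟩)
    (le_frameJoin x r 0 _)

theorem natCast (h : IsFrame x r) (m : ℕ) :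
    frameJoin x r (fun _ => m) (uniformRank L) = shift m x := by
  induction m with
  | zero =>
    rw [Nat.cast_zero, shift_zero]
    exact h.zero
  | succ m ih =>
    have := h.shift_one fun _ => m
    rw [ih, shift_shift] at this
    rw [Nat.cast_succ, add_comm (m : ℤ), this]
    rfl

theorem relLength_le (h : IsFrame x r) {z w : ℕ → ℕ} (j : ℕ) (hj : j ≤ uniformRank L)
    (hzw : ∀ i < j, z i ≤ w i) :
    relLength (frameJoin x r z j) (frameJoin x r w j) ≤ ∑ i ∈ Finset.range j, (w i - z i) := by
  induction j with
  | zero => simp [frameJoin, (HasMaximalChain.refl x).relLength_eq]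
  | succ j ih =>
    have hray := h.isRay j hj
    have h1 : frameJoin x r z j ≤ frameJoin x r w j :=
      h.mono (Nat.le_of_succ_le hj) fun i hi => hzw i (hi.trans (Nat.lt_succ_self j))
    have h2 : r j (z j) ≤ r j (w j) := hray.monotone (hzw j (Nat.lt_succ_self j))
    have h3 := relLength_sup_le (r j (z j)) h1
    have h4 := relLength_sup_le (frameJoin x r w j) h2
    rw [(HasMaximalChain.of_forall_covBy hray.covBy (hzw j (Nat.lt_succ_self j))).relLength_eq]
      at h4
    rw [sup_comm _ (frameJoin x r z j), sup_comm _ (frameJoin x r w j)] at h3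
    have h5 := ih (Nat.le_of_succ_le hj) fun i hi => hzw i (hi.trans (Nat.lt_succ_self j))
    rw [Finset.sum_range_succ, frameJoin, frameJoin,
      ← relLength_add (sup_le_sup_right h1 _) (sup_le_sup_left h2 _)]
    omega

/-- The rays of a frame are independent. The lengths of `[x, e z]`, `[e z, e w]` and
`[e w, (x)^{+M}]`, where `e z` is the join of the `r i (z i)`, have the obvious upper bounds; since
these add up to the length of `[x, (x)^{+M}]`, all of them are attained. -/
theorem relLength_eq (h : IsFrame x r) {z w : ℕ → ℕ} (hzw : ∀ i < uniformRank L, z i ≤ w i) :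
    relLength (frameJoin x r z (uniformRank L)) (frameJoin x r w (uniformRank L)) =
      ∑ i ∈ Finset.range (uniformRank L), (w i - z i) := by
  set M := ∑ i ∈ Finset.range (uniformRank L), w i
  have hM : ∀ i < uniformRank L, w i ≤ M := fun i hi =>
    Finset.single_le_sum (fun _ _ => Nat.zero_le _) (Finset.mem_range.2 hi)
  have h1 := h.relLength_le (z := 0) (w := z) _ le_rfl fun i _ => Nat.zero_le _
  have h2 := h.relLength_le _ le_rfl hzw
  have h3 := h.relLength_le (w := fun _ => M) _ le_rfl hM
  have h4 := relLength_shift_natCast M x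
  rw [← h.natCast M, ← relLength_add (le_frameJoin x r w _) (h.mono le_rfl hM),
    ← relLength_add (le_frameJoin x r z _) (h.mono le_rfl hzw)] at h4
  have h5 : ∑ i ∈ Finset.range (uniformRank L), (z i - (0 : ℕ → ℕ) i) +
      ∑ i ∈ Finset.range (uniformRank L), (w i - z i) +
      ∑ i ∈ Finset.range (uniformRank L), (M - w i) = M * uniformRank L := by
    rw [← Finset.sum_add_distrib, ← Finset.sum_add_distrib, mul_comm, ← smul_eq_mul]
    conv_rhs => rw [← Finset.card_range (uniformRank L), ← Finset.sum_const]
    refine Finset.sum_congr rfl fun i hi => ?_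
    have := hzw i (Finset.mem_range.1 hi)
    have := hM i (Finset.mem_range.1 hi)
    simp only [Pi.zero_apply]
    omega
  rw [h.zero] at h1
  omega

theorem le_iff (h : IsFrame x r) {z w : ℕ → ℕ} :
    frameJoin x r z (uniformRank L) ≤ frameJoin x r w (uniformRank L) ↔
      ∀ i < uniformRank L, z i ≤ w i := by
  refine ⟨fun hle i hi => ?_, fun hzw => h.mono le_rfl hzw⟩
  have h1 := h.relLength_eq (z := w) (w := z ⊔ w) fun i _ => le_sup_right
  rw [h.sup, sup_eq_right.2 hle, (HasMaximalChain.refl _).relLength_eq] at h1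
  have h2 := Finset.sum_eq_zero_iff.1 h1.symm i (Finset.mem_range.2 hi)
  exact le_sup_left.trans (Nat.sub_eq_zero_iff_le.1 h2)

theorem inf (h : IsFrame x r) (z w : ℕ → ℕ) :
    frameJoin x r (z ⊓ w) (uniformRank L) =
      frameJoin x r z (uniformRank L) ⊓ frameJoin x r w (uniformRank L) := by
  have hle : frameJoin x r (z ⊓ w) (uniformRank L) ≤
      frameJoin x r z (uniformRank L) ⊓ frameJoin x r w (uniformRank L) :=
    le_inf (h.mono le_rfl fun i _ => inf_le_left) (h.mono le_rfl fun i _ => inf_le_right)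
  refine eq_of_relLength_eq_zero hle ?_
  -- both `[e (z ⊓ w), e z]` and `[e w, e z ⊔ e w]` have length `∑ (z - w)`
  have h1 := h.relLength_eq (z := z ⊓ w) (w := z) fun i _ => inf_le_left
  have h2 := h.relLength_eq (z := w) (w := z ⊔ w) fun i _ => le_sup_right
  rw [← relLength_add hle inf_le_left] at h1
  have h3 := relLength_sup_le (frameJoin x r w (uniformRank L)) (inf_le_left :
    frameJoin x r z (uniformRank L) ⊓ frameJoin x r w (uniformRank L) ≤ _)
  rw [sup_eq_left.2 inf_le_right, sup_comm, ← h.sup, h2] at h3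
  have h4 : ∑ i ∈ Finset.range (uniformRank L), (z i - (z ⊓ w) i) =
      ∑ i ∈ Finset.range (uniformRank L), ((z ⊔ w) i - w i) :=
    Finset.sum_congr rfl fun i _ => by
      simp only [Pi.inf_apply, Pi.sup_apply]
      omega
  omega

end IsFrame

/-- The integer vector `z`, translated by `m` and truncated to a sequence of natural numbers. -/
def natCoords {n : ℕ} (z : Fin n → ℤ) (m : ℕ) : ℕ → ℕ :=
  fun i => if h : i < n then (z ⟨i, h⟩ + m).toNat else 0

/-- The point with integer coordinates `z` in a frame: `z` is translated by the constant vector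
`m = ∑ |z i|` to make it nonnegative, and the point obtained is shifted back. -/
noncomputable def framePoint (x : L) (r : ℕ → ℕ → L) (z : Fin (uniformRank L) → ℤ) : L :=
  shift (-(∑ i, (z i).natAbs : ℕ)) (frameJoin x r (natCoords z (∑ i, (z i).natAbs)) (uniformRank L))

namespace IsFrame

variable {x : L} {r : ℕ → ℕ → L}

theorem framePoint_eq (h : IsFrame x r) {z : Fin (uniformRank L) → ℤ} {m : ℕ}
    (hm : ∀ i, -(m : ℤ) ≤ z i) :
    framePoint x r z = shift (-m) (frameJoin x r (natCoords z m) (uniformRank L)) := by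
  have step : ∀ m k : ℕ, (∀ i, -(m : ℤ) ≤ z i) →
      shift (-(m + k : ℕ)) (frameJoin x r (natCoords z (m + k)) (uniformRank L)) =
        shift (-m) (frameJoin x r (natCoords z m) (uniformRank L)) := by
    intro m k hm
    induction k with
    | zero => rfl
    | succ k ih =>
      have h1 : frameJoin x r (natCoords z (m + (k + 1))) (uniformRank L) =
          frameJoin x r (natCoords z (m + k) + 1) (uniformRank L) := by
        refine h.congr fun i hi => ?_
        have := hm ⟨i, hi⟩
        simp only [natCoords, hi, dif_pos, Pi.add_apply, Pi.one_apply]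
        push_cast
        omega
      rw [← ih, h1, ← h.shift_one, shift_shift]
      congr 1
      push_cast
      ring
  have habs : ∀ i, -((∑ i, (z i).natAbs : ℕ) : ℤ) ≤ z i := by
    intro i
    have : (z i).natAbs ≤ ∑ i, (z i).natAbs :=
      Finset.single_le_sum (f := fun i => (z i).natAbs) (fun _ _ => Nat.zero_le _)
        (Finset.mem_univ i)
    omega
  rw [framePoint, ← step _ m habs, Nat.add_comm, step m _ hm]

theorem exists_common (z w : Fin (uniformRank L) → ℤ) :
    ∃ m : ℕ, (∀ i, -(m : ℤ) ≤ z i) ∧ ∀ i, -(m : ℤ) ≤ w i := by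
  refine ⟨∑ i, ((z i).natAbs + (w i).natAbs), ?_⟩
  have key : ∀ i, (z i).natAbs + (w i).natAbs ≤ ∑ i, ((z i).natAbs + (w i).natAbs) := fun i =>
    Finset.single_le_sum (f := fun i => (z i).natAbs + (w i).natAbs) (fun _ _ => Nat.zero_le _)
      (Finset.mem_univ i)
  constructor <;> intro i <;> have := key i <;> omega

theorem framePoint_le_iff (h : IsFrame x r) {z w : Fin (uniformRank L) → ℤ} :
    framePoint x r z ≤ framePoint x r w ↔ z ≤ w := by
  obtain ⟨m, hz, hw⟩ := exists_common z w
  rw [h.framePoint_eq hz, h.framePoint_eq hw, shift_le_shift_iff, h.le_iff]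
  constructor
  · intro hle i
    show z i ≤ w i
    have h1 := hle i i.2
    have h2 := hz i
    have h3 := hw i
    simp only [natCoords, i.2, dif_pos, Fin.eta] at h1
    omega
  · intro hle i hi
    have : z ⟨i, hi⟩ ≤ w ⟨i, hi⟩ := hle ⟨i, hi⟩
    simp only [natCoords, hi, dif_pos]
    omega

theorem framePoint_sup (h : IsFrame x r) (z w : Fin (uniformRank L) → ℤ) :
    framePoint x r z ⊔ framePoint x r w = framePoint x r (z ⊔ w) := by
  obtain ⟨m, hz, hw⟩ := exists_common z w
  rw [h.framePoint_eq hz, h.framePoint_eq hw,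
    h.framePoint_eq (z := z ⊔ w) fun i => (hz i).trans le_sup_left, ← shift_sup, ← h.sup]
  congr 1
  refine h.congr fun i hi => ?_
  simp only [natCoords, hi, dif_pos, Pi.sup_apply]
  omega

theorem framePoint_inf (h : IsFrame x r) (z w : Fin (uniformRank L) → ℤ) :
    framePoint x r z ⊓ framePoint x r w = framePoint x r (z ⊓ w) := by
  obtain ⟨m, hz, hw⟩ := exists_common z w
  rw [h.framePoint_eq hz, h.framePoint_eq hw,
    h.framePoint_eq (z := z ⊓ w) fun i => le_inf (hz i) (hw i), ← shift_inf, ← h.inf]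
  congr 1
  refine h.congr fun i hi => ?_
  simp only [natCoords, hi, dif_pos, Pi.inf_apply]
  omega

theorem framePoint_add_one (h : IsFrame x r) (z : Fin (uniformRank L) → ℤ) :
    framePoint x r (z + 1) = shift 1 (framePoint x r z) := by
  obtain ⟨m, hz, hw⟩ := exists_common z (z + 1)
  rw [h.framePoint_eq hz, h.framePoint_eq hw, shift_shift, add_comm 1, ← shift_shift, h.shift_one]
  congr 1
  refine h.congr fun i hi => ?_
  have := hz ⟨i, hi⟩
  simp only [natCoords, hi, dif_pos, Pi.add_apply, Pi.one_apply]
  omega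

theorem framePoint_natCast (h : IsFrame x r) (z : ℕ → ℕ) :
    framePoint x r (fun i => (z i : ℤ)) = frameJoin x r z (uniformRank L) := by
  rw [h.framePoint_eq (m := 0) fun i => by simp]
  simp only [Nat.cast_zero, neg_zero, shift_zero]
  refine h.congr fun i hi => ?_
  simp [natCoords, hi]

/-- The sublattice of all points with integer coordinates in a frame. -/
def skeleton (h : IsFrame x r) : Sublattice L where
  carrier := Set.range (framePoint x r)
  supClosed' := by
    rintro _ ⟨z, rfl⟩ _ ⟨w, rfl⟩
    exact ⟨_, (h.framePoint_sup z w).symm⟩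
  infClosed' := by
    rintro _ ⟨z, rfl⟩ _ ⟨w, rfl⟩
    exact ⟨_, (h.framePoint_inf z w).symm⟩

theorem mem_skeleton (h : IsFrame x r) {y : L} :
    y ∈ h.skeleton ↔ ∃ z, framePoint x r z = y := Iff.rfl

theorem isSkeleton (h : IsFrame x r) : IsSkeleton h.skeleton := by
  let e : (Fin (uniformRank L) → ℤ) ≃o h.skeleton :=
    (OrderEmbedding.ofMapLEIff (framePoint x r) fun _ _ => h.framePoint_le_iff).orderIso
  have he : ∀ z, (e z : L) = framePoint x r z := fun z => rfl
  refine ⟨⟨e⟩, fun s => e (e.symm s + 1), ?_, fun s => ?_⟩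
  · intro s
    have h1 := (e.isLUB_image' (s := {y | e.symm s ⋖ y}) (x := e.symm s + 1)).2
      (isAscendingOperator_int _ _)
    have h2 : e '' {y | e.symm s ⋖ y} = {y | s ⋖ y} := by
      ext y
      rw [e.image_eq_preimage_symm, Set.mem_preimage, Set.mem_ofPred_eq, Set.mem_ofPred_eq,
        apply_covBy_apply_iff]
    rwa [h2] at h1
  · show (e (e.symm s + 1) : L) = ascOp (s : L)
    rw [he, h.framePoint_add_one, ← he, e.apply_symm_apply, _root_.shift_one]

end IsFrame

end Frame

/-! ### Frames adapted to a pair of comparable elements -/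

section Adapted

variable {L : Type*} [Lattice L] [UniformModularLattice L]

theorem exists_chain_through {U : ℕ → L} (hU : Antitone U) {b : L} (hb : U 0 ≤ b) (d : ℕ) :
    ∃ (m : ℕ) (f : ℕ → L), f 0 = U d ∧ f m = b ∧ (∀ i < m, f i ⋖ f (i + 1)) ∧
      ∀ k ≤ d, ∃ j ≤ m, f j = U k := by
  induction d with
  | zero =>
    obtain ⟨m, f, h0, h1, hf⟩ := exists_hasMaximalChain hb
    refine ⟨m, f, h0, h1, hf, fun k hk => ⟨0, Nat.zero_le m, ?_⟩⟩
    rw [h0, Nat.le_zero.1 hk]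
  | succ d ih =>
    obtain ⟨m, f, h0, h1, hf, hk⟩ := ih
    obtain ⟨m', g, g0, g1, hg⟩ := exists_hasMaximalChain (hU (Nat.le_succ d))
    have hglue : ∀ j, (if m' + j ≤ m' then g (m' + j) else f (m' + j - m')) = f j := by
      rintro (_ | j)
      · simp [g1, h0]
      · simp
    refine ⟨m' + m, fun i => if i ≤ m' then g i else f (i - m'), by simp [g0], ?_, ?_, ?_⟩
    · exact (hglue m).trans h1
    · intro i hi
      rcases lt_or_ge i m' with h | h
      · simpa [h.le, Nat.succ_le_of_lt h] using hg i h
      · obtain ⟨j, rfl⟩ := Nat.exists_eq_add_of_le h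
        show (if m' + j ≤ m' then g (m' + j) else f (m' + j - m')) ⋖
          (if m' + (j + 1) ≤ m' then g (m' + (j + 1)) else f (m' + (j + 1) - m'))
        rw [hglue, hglue]
        exact hf j (by omega)
    · intro k hkd
      rcases Nat.le_succ_iff.1 hkd with h | rfl
      · obtain ⟨j, hj, hjk⟩ := hk k h
        exact ⟨m' + j, by omega, (hglue j).trans hjk⟩
      · exact ⟨0, Nat.zero_le _, by simp [g0]⟩

/-- Any two comparable elements `x ≤ y` lie in a common frame. The layers
`y ⊓ (x)^{+(k+1)}` of `[x, y]`, shifted back into `[x, (x)⁺]`, form a descending flag `U`; the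
directions of the rays are chosen along a maximal chain refining `U`, and each ray stays below `y`
for as many steps as there are members of `U` above its direction. -/
theorem exists_isFrame {x y : L} (hxy : x ≤ y) :
    ∃ (r : ℕ → ℕ → L) (z : ℕ → ℕ), IsFrame x r ∧ frameJoin x r z (uniformRank L) = y := by
  set U : ℕ → L := fun k => (x ⊔ shift (-k) y) ⊓ shift 1 x with hUdef
  have hU : Antitone U := fun a b hab =>
    inf_le_inf_right _ (sup_le_sup_left (shift_mono_left (by omega) y) x)
  obtain ⟨d, hd⟩ := exists_le_shift hxy
  have hUd : U d = x := by
    have : shift (-d) y ≤ x := by rwa [shift_le_iff, neg_neg]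
    rw [hUdef]
    simp only
    rw [sup_eq_left.2 this, inf_eq_left.2 (le_shift_one x)]
  obtain ⟨m, f, f0, f1, hf, hfU⟩ := exists_chain_through hU inf_le_right d
  rw [hUd] at f0
  obtain rfl : m = uniformRank L := by
    rw [← relLength_shift_one x]
    exact (HasMaximalChain.relLength_eq ⟨f, f0, f1, hf⟩).symm
  have hmono : ∀ i j, i ≤ j → j ≤ uniformRank L → f i ≤ f j := by
    intro i j hij
    induction j, hij using Nat.le_induction with
    | base => exact fun _ => le_rfl
    | succ j _ ih => exact fun hj => (ih (by omega)).trans (hf j (by omega)).le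
  have hfU' : ∀ k, ∃ j ≤ uniformRank L, f j = U k := by
    intro k
    rcases le_total k d with h | h
    · exact hfU k h
    · refine ⟨0, Nat.zero_le _, ?_⟩
      rw [f0]
      refine le_antisymm (le_inf le_sup_left (le_shift_one x)) ?_
      exact hUd ▸ hU h
  have hray : ∀ i, ∃ (r : ℕ → L) (z : ℕ), i < uniformRank L → IsRay x r ∧ r 1 ≤ f (i + 1) ∧
      ¬ r 1 ≤ f i ∧ r z ≤ y ∧ ∀ k, f (i + 1) ≤ U k → k < z := by
    intro i
    by_cases hi : i < uniformRank L
    swap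
    · exact ⟨fun _ => x, 0, fun h => absurd h hi⟩
    have hxf : x ≤ f i := f0.ge.trans (hmono 0 i (Nat.zero_le i) hi.le)
    have hfx : f (i + 1) ≤ shift 1 x := (hmono (i + 1) _ hi le_rfl).trans f1.le
    have hex : ∃ k, ¬ f (i + 1) ≤ U k :=
      ⟨d, fun h => (hf i hi).lt.not_ge (h.trans (hUd.le.trans hxf))⟩
    classical
    have hspec := Nat.find_spec hex
    have hlt : ∀ k, f (i + 1) ≤ U k → k < Nat.find hex := fun k hk => by
      by_contra hge
      exact hspec (hk.trans (hU (not_lt.1 hge)))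
    rcases hz : Nat.find hex with _ | k
    · obtain ⟨r, hr, h1, h2, -⟩ := exists_isRay hxf (hf i hi) hfx 0 (hxf.trans (hf i hi).le)
        (by simp)
      rw [hz] at hlt
      exact ⟨r, 0, fun _ => ⟨hr, h1, h2, hr.zero.le.trans hxy, hlt⟩⟩
    · have hk : f (i + 1) ≤ U k := by
        by_contra h
        have := Nat.find_min' hex h
        omega
      obtain ⟨r, hr, h1, h2, h3⟩ := exists_isRay hxf (hf i hi) hfx k hxy (by
        refine ((shift_le_shift_iff k).2 (hk.trans inf_le_left)).trans ?_
        rw [shift_sup, shift_shift, add_neg_cancel, shift_zero]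
        exact sup_le_sup_right ((shift_le_shift_iff k).2 hxf) y)
      rw [hz] at hlt
      exact ⟨r, k + 1, fun _ => ⟨hr, h1, h2, h3, hlt⟩⟩
  choose r z hrz using hray
  have hspan : ∀ j ≤ uniformRank L, f j ≤ frameJoin x r (fun _ => 1) j := by
    intro j
    induction j with
    | zero => exact fun _ => f0.le
    | succ j ih =>
      intro hj
      obtain ⟨-, h1, h2, -⟩ := hrz j hj
      rw [← (hf j hj).sup_eq_of_not_le h1 h2]
      exact sup_le_sup_right (ih (by omega)) _
  refine ⟨r, z, ⟨fun i hi => (hrz i hi).1, f1.ge.trans (hspan _ le_rfl)⟩, ?_⟩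
  set e := frameJoin x r z (uniformRank L) with he
  have hey : e ≤ y := frameJoin_le_iff.2 ⟨hxy, fun i hi => (hrz i hi).2.2.2.1⟩
  refine le_antisymm hey ?_
  have key : ∀ k : ℕ, y ⊓ shift k x ≤ e := by
    intro k
    induction k with
    | zero => simpa using inf_le_of_right_le (le_frameJoin x r z _)
    | succ k ih =>
      obtain ⟨j, hj, hjU⟩ := hfU' k
      have h1 : shift k (U k) ≤ shift k x ⊔ e := by
        rw [← hjU, shift_le_iff]
        refine (hspan j hj).trans (frameJoin_le_iff.2 ⟨?_, fun i hi => ?_⟩)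
        · rw [← shift_le_iff]
          exact le_sup_left
        · obtain ⟨hr, -, -, -, hlt⟩ := hrz i (hi.trans_le hj)
          rw [← shift_le_iff]
          refine (hr.shift_le 1 k).trans (sup_le_sup_left ?_ _)
          have hk : k < z i := hlt k ((hmono (i + 1) j hi hj).trans hjU.le)
          exact (hr.monotone (by omega)).trans (apply_le_frameJoin x r z (hi.trans_le hj))
      have h2 : y ⊓ shift ((k + 1 : ℕ) : ℤ) x ≤ shift k (U k) := by
        rw [hUdef]
        simp only
        rw [shift_inf, shift_sup, shift_shift, shift_shift, add_neg_cancel, shift_zero,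
          Nat.cast_succ]
        exact inf_le_inf_right _ le_sup_right
      have h3 : y ⊓ shift ((k + 1 : ℕ) : ℤ) x ≤ y ⊓ (shift k x ⊔ e) :=
        le_inf inf_le_left (h2.trans h1)
      refine h3.trans ((inf_sup_le_assoc_of_le _ hey).trans (sup_le ih le_rfl))
  exact (le_inf le_rfl hd).trans (key d)

theorem linfDist_le_iff {x y : L} (hxy : x ≤ y) {m : ℕ} :
    linfDist x y ≤ m ↔ y ≤ shift m x := by
  obtain ⟨r, z, h, hz⟩ := exists_isFrame hxy
  have hS := h.isSkeleton
  have hxS : x ∈ h.skeleton := h.mem_skeleton.2 ⟨_, (h.framePoint_natCast 0).trans h.zero⟩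
  have hyS : y ∈ h.skeleton := h.mem_skeleton.2 ⟨_, (h.framePoint_natCast z).trans hz⟩
  obtain ⟨e⟩ := hS.iso
  have ha : (e (e.symm ⟨x, hxS⟩) : L) = x := by rw [e.apply_symm_apply]
  have hb : (e (e.symm ⟨y, hyS⟩) : L) = y := by rw [e.apply_symm_apply]
  have h1 := hS.supDist_le_iff e (e.symm ⟨x, hxS⟩) (e.symm ⟨y, hyS⟩) m
  rw [← linfDist_eq hS e, ha, hb, ← shift_natCast, ← shift_natCast] at h1
  rw [h1, and_iff_left_iff_imp]
  intro _
  refine hxy.trans ?_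
  simpa using shift_mono_left (Int.natCast_nonneg m) y

end Adapted

/-! ### Steepest descent -/

section Descent

variable {L : Type*} [Lattice L] [UniformModularLattice L] {g : L → WithTop ℝ}

/-- A submodular function that is bounded below attains its minimum over every interval. The
interval may be infinite; instead of finiteness, the argument uses that values close to the infimum
are preserved by joins. -/
theorem exists_min_Icc (hg : ∀ x y, g (x ⊓ y) + g (x ⊔ y) ≤ g x + g y) {B : ℝ}
    (hB : ∀ x, (B : WithTop ℝ) ≤ g x) {a b : L} (hab : a ≤ b) :
    ∃ y ∈ Set.Icc a b, ∀ z ∈ Set.Icc a b, g y ≤ g z := by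
  by_cases htop : ∀ z ∈ Set.Icc a b, g z = ⊤
  · exact ⟨a, ⟨le_rfl, hab⟩, fun z hz => by rw [htop z hz]; exact le_top⟩
  push Not at htop
  obtain ⟨w, hw, hwt⟩ := htop
  -- `v` is the infimum of the finite values on the interval
  set V : Set ℝ := {v | ∃ z ∈ Set.Icc a b, g z = v} with hV
  have hVne : V.Nonempty := by
    lift g w to ℝ using hwt with v hv
    exact ⟨v, w, hw, hv.symm⟩
  have hVbdd : BddBelow V := by
    refine ⟨B, ?_⟩
    rintro v ⟨z, -, hz⟩
    have := hB z
    rw [hz] at this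
    exact WithTop.coe_le_coe.1 this
  set v := sInf V
  have hlow : ∀ z ∈ Set.Icc a b, (v : WithTop ℝ) ≤ g z := by
    intro z hz
    by_cases hzt : g z = ⊤
    · rw [hzt]
      exact le_top
    · lift g z to ℝ using hzt with c hc
      exact WithTop.coe_le_coe.2 (csInf_le hVbdd ⟨z, hz, hc.symm⟩)
  have happrox : ∀ ε > 0, ∃ z ∈ Set.Icc a b, g z ≤ ((v + ε : ℝ) : WithTop ℝ) := by
    intro ε hε
    obtain ⟨c, ⟨z, hz, hc⟩, hlt⟩ := exists_lt_of_csInf_lt hVne (lt_add_of_pos_right v hε)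
    exact ⟨z, hz, by rw [hc]; exact WithTop.coe_le_coe.2 hlt.le⟩
  have hsup : ∀ y ∈ Set.Icc a b, ∀ z ∈ Set.Icc a b, ∀ ε δ : ℝ,
      g y ≤ ((v + ε : ℝ) : WithTop ℝ) → g z ≤ ((v + δ : ℝ) : WithTop ℝ) →
      g (y ⊔ z) ≤ ((v + (ε + δ) : ℝ) : WithTop ℝ) := by
    intro y hy z hz ε δ h1 h2
    have h3 := (add_le_add_left (hlow (y ⊓ z) ⟨le_inf hy.1 hz.1, inf_le_left.trans hy.2⟩)
      (g (y ⊔ z))).trans ((hg y z).trans (add_le_add h1 h2))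
    by_cases ht : g (y ⊔ z) = ⊤
    · rw [ht, WithTop.add_top, ← WithTop.coe_add] at h3
      exact absurd h3 (WithTop.coe_lt_top _).not_ge
    · lift g (y ⊔ z) to ℝ using ht with c hc
      rw [← WithTop.coe_add, ← WithTop.coe_add, WithTop.coe_le_coe] at h3
      exact WithTop.coe_le_coe.2 (by linarith)
  -- a minimal `z` whose lower interval `[a, z]` still has infimum `v`
  obtain ⟨z, hz, hzv, hmin⟩ := exists_minimal_Icc (a := a) (b := b)
    (fun z => ∀ ε > 0, ∃ y ∈ Set.Icc a b, y ≤ z ∧ g y ≤ ((v + ε : ℝ) : WithTop ℝ))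
    ⟨b, ⟨hab, le_rfl⟩, fun ε hε => by
      obtain ⟨y, hy, hyv⟩ := happrox ε hε
      exact ⟨y, hy, hy.2, hyv⟩⟩
  have hle : ∀ ε > 0, g z ≤ ((v + ε : ℝ) : WithTop ℝ) := by
    intro ε hε
    obtain ⟨u, hu, ⟨huz, δ, hδ, huv⟩, hmax⟩ := exists_maximal_Icc (a := a) (b := b)
      (fun u => u ≤ z ∧ ∃ δ < ε, g u ≤ ((v + δ : ℝ) : WithTop ℝ)) (by
        obtain ⟨y, hy, hyz, hyv⟩ := hzv (ε / 2) (half_pos hε)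
        exact ⟨y, hy, hyz, ε / 2, half_lt_self hε, hyv⟩)
    -- `u` lies above near-minimizers of every precision, hence equals `z` by minimality of `z`
    have huz' : u = z := by
      refine hmin u hu (fun η hη => ?_) huz
      obtain ⟨y, hy, hyz, hyv⟩ := hzv (min η ((ε - δ) / 2)) (lt_min hη (by linarith))
      have h1 := hmax (u ⊔ y) ⟨hu.1.trans le_sup_left, sup_le hu.2 hy.2⟩
        ⟨sup_le huz hyz, δ + min η ((ε - δ) / 2),
          by linarith [min_le_right η ((ε - δ) / 2)], hsup u hu y hy _ _ huv hyv⟩ le_sup_left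
      refine ⟨y, hy, sup_eq_left.1 h1, hyv.trans (WithTop.coe_le_coe.2 ?_)⟩
      linarith [min_le_left η ((ε - δ) / 2)]
    rw [← huz']
    exact huv.trans (WithTop.coe_le_coe.2 (by linarith))
  refine ⟨z, hz, fun w hw => le_trans ?_ (hlow w hw)⟩
  have hzt : g z ≠ ⊤ := fun h => by
    have := hle 1 one_pos
    rw [h] at this
    exact (WithTop.coe_lt_top _).not_ge this
  lift g z to ℝ using hzt with c hc
  exact WithTop.coe_le_coe.2 (le_of_forall_pos_le_add fun ε hε => WithTop.coe_le_coe.1 (hle ε hε))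

theorem IsLConvex.apply_shift (hg : IsLConvex g) {y : L} (hy : IsMinimizer g y) (hyt : g y < ⊤)
    (k : ℤ) (x : L) : g (shift k x) = g x := by
  obtain ⟨α, hα⟩ := hg.linear
  -- a nonzero increment `α` would give values below `g y` at `(y)⁺` or at its inverse image
  obtain rfl : α = 0 := by
    have h1 : g y ≤ g y + (α : WithTop ℝ) := (hy (ascOp y)).trans (hα y).le
    have h2 : g (ascOp.symm y) + (α : WithTop ℝ) = g y := by
      rw [← hα, OrderIso.apply_symm_apply]
    have h3 : g y + (α : WithTop ℝ) ≤ g y := by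
      rw [← h2]
      gcongr
      rw [h2]
      exact hy _
    lift g y to ℝ using hyt.ne with c
    rw [← WithTop.coe_add, WithTop.coe_le_coe] at h1 h3
    linarith
  have h1 : ∀ x, g (shift 1 x) = g x := fun x => by
    rw [shift_one, hα, WithTop.coe_zero, add_zero]
  induction k with
  | zero => rw [shift_zero]
  | succ k ih => rw [add_comm, ← shift_shift, h1, ih]
  | pred k ih => rw [← ih, ← h1 (shift (-k - 1) x), shift_shift, add_sub_cancel]

/-- A steepest descent step from `x` to `y` brings the minimizers one step closer: if `p` is a
minimizer in `[x, (x)^{+(k+1)}]`, then `(p ⊓ (y)^{+k}) ⊔ y` is one in `[y, (y)^{+k}]`. -/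
theorem IsSteepestDirection.exists_isMinimizer (hg : IsLConvex g) {x y p : L} {k : ℕ}
    (hxt : g x < ⊤) (hy : IsSteepestDirection g x y) (hp : IsMinimizer g p) (hxp : x ≤ p)
    (hpk : p ≤ shift (k + 1) x) : ∃ q, IsMinimizer g q ∧ y ≤ q ∧ q ≤ shift k y := by
  have hsh := hg.apply_shift hp ((hp x).trans_lt hxt)
  obtain ⟨⟨hxy, hyx⟩, hmin⟩ := hy
  rw [← shift_one] at hyx
  simp only [← shift_one] at hmin
  have hyt : g y < ⊤ := (hmin x ⟨le_rfl, le_shift_one x⟩).trans_lt hxt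
  have hpt : g p < ⊤ := (hp x).trans_lt hxt
  have hyk : y ≤ shift k y := by simpa using shift_mono_left (Int.natCast_nonneg k) y
  have cancel : ∀ u w : L, g w < ⊤ → g y ≤ g u → IsMinimizer g w →
      ∀ s, g s + g u ≤ g y + g w → IsMinimizer g s := by
    intro u w hwt hyu hw s h z
    refine le_trans ?_ (hw z)
    have h1 : g y + g s ≤ g y + g w := by
      refine le_trans ?_ h
      rw [add_comm]
      gcongr
    exact (WithTop.add_le_add_iff_left hyt.ne).1 h1
  have hmeet : IsMinimizer g (p ⊓ shift k y) := by
    refine cancel (p ⊔ shift k y) p hpt ?_ hp _ ?_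
    · rw [← hsh (-k) (p ⊔ shift k y)]
      refine hmin _ ⟨?_, ?_⟩
      · rw [shift_sup, shift_shift, neg_add_cancel, shift_zero]
        exact hxy.trans le_sup_right
      · rw [shift_le_iff, neg_neg, shift_shift]
        refine sup_le hpk ?_
        rw [← shift_shift, shift_le_shift_iff]
        exact hyx
    · have := hg.submodular p (shift k y)
      rwa [hsh, add_comm (g p)] at this
  refine ⟨(p ⊓ shift k y) ⊔ y, ?_, le_sup_right, sup_le inf_le_right hyk⟩
  refine cancel ((p ⊓ shift k y) ⊓ y) _ ((hmeet x).trans_lt hxt) ?_ hmeet _ ?_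
  · exact hmin _ ⟨le_inf (le_inf hxp (hxy.trans hyk)) hxy, inf_le_right.trans hyx⟩
  · have := hg.submodular (p ⊓ shift k y) y
    rwa [add_comm (g _), add_comm (g _) (g y)] at this

theorem exists_isSDARun (hg : IsLConvex g) {y : L} (hy : IsMinimizer g y) (hyt : g y < ⊤) (x₀ : L) :
    ∃ x : ℕ → Option L, IsSDARun g x₀ x := by
  have hsteep : ∀ p, ∃ q, IsSteepestDirection g p q := by
    intro p
    have hB : ∀ x, (((g y).untop hyt.ne : ℝ) : WithTop ℝ) ≤ g x := fun x => by
      rw [WithTop.coe_untop]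
      exact hy x
    refine exists_min_Icc hg.submodular hB ?_
    rw [← shift_one]
    exact le_shift_one p
  choose s hs using hsteep
  classical
  refine ⟨fun i => Nat.rec (some x₀)
    (fun _ o => o.bind fun p => if g (s p) < g p then some (s p) else none) i, rfl, ?_, ?_⟩
  · intro i p hp
    refine ⟨s p, hs p, ?_⟩
    by_cases h : g (s p) < g p
    · exact Or.inl ⟨h, by simp only [hp, Option.bind_some, if_pos h]⟩
    · exact Or.inr ⟨h, by simp only [hp, Option.bind_some, if_neg h]⟩
  · intro i hi
    simp only [hi, Option.bind_none]

theorem IsSDARun.isMinimizer (hg : IsLConvex g) {x₀ : L} {x : ℕ → Option L}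
    (hx : IsSDARun g x₀ x) (k : ℕ) : ∀ (i : ℕ) (p : L), x i = some p → g p < ⊤ →
      (∃ y, IsMinimizer g y ∧ p ≤ y ∧ y ≤ shift k p) →
      (∀ (j : ℕ) (y : L), IsMinimizer g y → p ≤ y → y ≤ shift j p → k ≤ j) →
      ∃ q, x (i + k) = some q ∧ IsMinimizer g q := by
  induction k with
  | zero =>
    rintro i p hi - ⟨y, hy, hpy, hyp⟩ -
    rw [Nat.cast_zero, shift_zero] at hyp
    exact ⟨p, hi, le_antisymm hyp hpy ▸ hy⟩
  | succ k ih =>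
    rintro i p hi hpt ⟨y, hy, hpy, hyp⟩ hmin
    rw [Nat.cast_succ] at hyp
    obtain ⟨s, hs, ⟨hlt, hs1⟩ | ⟨hlt, -⟩⟩ := hx.step i p hi
    · rw [Nat.add_comm k 1, ← Nat.add_assoc]
      refine ih (i + 1) s hs1 (hlt.trans hpt) (hs.exists_isMinimizer hg hpt hy hpy hyp) ?_
      intro j q hq hsq hqj
      have := hmin (j + 1) q hq (hs.1.1.trans hsq) (by
        refine hqj.trans ?_
        rw [Nat.cast_succ, ← shift_shift, shift_le_shift_iff, shift_one]
        exact hs.1.2)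
      omega
    · -- if no step decreases `g`, then `p` itself is a steepest direction at `p`
      exfalso
      have hp : IsSteepestDirection g p p :=
        ⟨⟨le_rfl, hs.1.1.trans hs.1.2⟩, fun z hz => (not_lt.1 hlt).trans (hs.2 z hz)⟩
      obtain ⟨q, hq, hpq, hqk⟩ := hp.exists_isMinimizer hg hpt hy hpy hyp
      have := hmin k q hq hpq hqk
      omega

end Descent

theorem theorem3p3 {L : Type*} [Lattice L] [UniformModularLattice L] (g : L → WithTop ℝ)
    (hg : IsLConvex g) (hmin : ∃ y, IsMinimizer g y) (x₀ : L) (hx₀ : g x₀ < ⊤) :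
    ∃ k : ℕ,
      IsLeast {d : ℕ | ∃ y, IsMinimizer g y ∧ x₀ ≤ y ∧ d = linfDist x₀ y} k ∧
      (∃ x : ℕ → Option L, IsSDARun g x₀ x) ∧
      ∀ x : ℕ → Option L, IsSDARun g x₀ x → ∃ p, x k = some p ∧ IsMinimizer g p := by
  obtain ⟨y, hy⟩ := hmin
  have hyt : g y < ⊤ := (hy x₀).trans_lt hx₀
  have hne : {d : ℕ | ∃ y, IsMinimizer g y ∧ x₀ ≤ y ∧ d = linfDist x₀ y}.Nonempty := by
    -- a sufficiently high shift of `y` is a minimizer above `x₀`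
    obtain ⟨m, hm⟩ := exists_le_shift (inf_le_left : x₀ ⊓ y ≤ x₀)
    refine ⟨_, shift m y, fun z => ?_, hm.trans ((shift_le_shift_iff m).2 inf_le_right), rfl⟩
    rw [hg.apply_shift hy hyt]
    exact hy z
  refine ⟨_, ⟨Nat.sInf_mem hne, fun d hd => Nat.sInf_le hd⟩, exists_isSDARun hg hy hyt x₀, ?_⟩
  intro x hx
  obtain ⟨q, hq, hxq, hk⟩ := Nat.sInf_mem hne
  have := hx.isMinimizer hg _ 0 x₀ hx.init hx₀ ⟨q, hq, hxq, (linfDist_le_iff hxq).1 hk.ge⟩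
    fun j p hp hxp hpj => le_trans (Nat.sInf_le (s := {d | ∃ y, IsMinimizer g y ∧ x₀ ≤ y ∧
      d = linfDist x₀ y}) ⟨p, hp, hxp, rfl⟩) ((linfDist_le_iff hxp).2 hpj)
  rwa [Nat.zero_add] at this
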